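/- A closed convex cone $K$ in a finite-dimensional real vector space $\mathcal V$ is \emph{pointed} if $K\cap(-K)=\{0\}$, \emph{full-dimensional} if its linear span is $\mathcal V$, and \emph{homogeneous} if the group of invertible linear maps $A$ of $\mathcal V$ with $AK=K$ acts transitively on the relative interior of $K$. A homogeneous polynomial $p:\mathcal V\to\mathbb R$ is \emph{hyperbolic along} $e\in\mathcal V$ if $p(e)>0$ and, for every $x\in\mathcal V$, all complex roots of $t\mapsto p(x-te)$ are real; its \emph{hyperbolicity cone} is $\Lambda_+(p,e)=\{x\in\mathcal V:\text{all roots of }t\mapsto p(te-x)\text{ are nonnegative}\}$, and the \emph{rank} of $x$ is the number, counted with multiplicity, of nonzero roots of $t\mapsto p(te-x)$. A closed convex cone $K\subseteq\mathcal V$ is \emph{realizable as a rank-one generated (ROG) hyperbolicity cone} if $K=\Lambda_+(p,e)$ for some $e\in\mathcal V$ and some $p$ hyperbolic along $e$ such that every nonzero element generating an extreme ray (a one-dimensional face that is a half-line) of $\Lambda_+(p,e)$ has rank $1$ with respect to $p$ and $e$. \textbf{Corollary.} The Vinberg cone $$\left\{(y_1,y_2,y_3,y_4,y_5)\in\mathbb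 R^5 \;:\; \begin{pmatrix} y_1&y_2\\ y_2&y_4\end{pmatrix}\succeq 0,\ \begin{pmatrix} y_1&y_3\\ y_3&y_5\end{pmatrix}\succeq 0\right\}$$ is a pointed, full-dimensional homogeneous closed convex cone in $\mathbb R^5$ that is not realizable as a ROG hyperbolicity cone. Consequently, it is not true that for every $n$ every pointed, full-dimensional homogeneous closed convex cone in $\mathbb R^n$ is realizable as a ROG hyperbolicity cone. -/

import Mathlib

noncomputable section

namespace VinbergROG

/-! ### Closed convex cones and homogeneity -/

section Cones

variable {V : Type*} [NormedAddCommGroup V] [NormedSpace ℝ V]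

/-- `K` is a closed convex cone (containing the origin) in the real normed space `V`. -/
structure IsClosedConvexCone (K : Set V) : Prop where
  zero_mem : (0 : V) ∈ K
  smul_mem : ∀ c : ℝ, 0 ≤ c → ∀ x ∈ K, c • x ∈ K
  convex : Convex ℝ K
  isClosed : IsClosed K

/-- `K ∩ -K = {0}`. -/
def IsPointed (K : Set V) : Prop := K ∩ {x | -x ∈ K} = {0}

/-- The linear span of `K` is the whole space. -/
def IsFullDimensional (K : Set V) : Prop := Submodule.span ℝ K = ⊤

/-- `A` is an automorphism of the cone `K`: an invertible linear map of `V` with `A K = K`. -/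
def IsConeAut (K : Set V) (A : V ≃ₗ[ℝ] V) : Prop := A '' K = K

/-- A homogeneous cone: a closed convex cone whose automorphism group acts transitively on its
relative interior. -/
structure IsHomogeneousCone (K : Set V) : Prop where
  isClosedConvexCone : IsClosedConvexCone K
  transitive : ∀ x ∈ intrinsicInterior ℝ K, ∀ y ∈ intrinsicInterior ℝ K,
    ∃ A : V ≃ₗ[ℝ] V, IsConeAut K A ∧ A x = y

/-- The half-line generated by `x`. -/
def ray (x : V) : Set V := {y | ∃ c : ℝ, 0 ≤ c ∧ y = c • x}

/-- The element `x` generates an extreme ray of `K`: it is nonzero and the half-line that it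
spans is a face of `K`. -/
def GeneratesExtremeRay (K : Set V) (x : V) : Prop := x ≠ 0 ∧ IsExtreme ℝ K (ray x)

end Cones

/-! ### Hyperbolic polynomials on `ℝⁿ` -/

section Hyperbolic

variable {n : ℕ}

/-- The univariate polynomial `t ↦ p (a + t b)`. -/
def restrictLine (p : MvPolynomial (Fin n) ℝ) (a b : Fin n → ℝ) : Polynomial ℝ :=
  MvPolynomial.aeval
    (fun i => Polynomial.C (a i) + Polynomial.X * Polynomial.C (b i)) p

theorem eval_restrictLine (p : MvPolynomial (Fin n) ℝ) (a b : Fin n → ℝ) (t : ℝ) :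
    (restrictLine p a b).eval t = MvPolynomial.eval (a + t • b) p := by
  unfold restrictLine
  rw [← Polynomial.coe_evalRingHom, MvPolynomial.aeval_def, MvPolynomial.hom_eval₂]
  have h : (Polynomial.evalRingHom t).comp (algebraMap ℝ (Polynomial ℝ)) = RingHom.id ℝ := by
    ext; simp
  rw [h, ← MvPolynomial.eval₂_id]
  congr 1
  funext i
  simp
  ring

/-- `p` is a homogeneous polynomial that is hyperbolic along `e`: `p e > 0`, and for every `x` all
(complex) roots of `t ↦ p (x - t e)` are real, that is, this polynomial splits over `ℝ`. -/
def IsHyperbolic (p : MvPolynomial (Fin n) ℝ) (e : Fin n → ℝ) : Prop :=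
  (∃ d : ℕ, p.IsHomogeneous d) ∧ 0 < MvPolynomial.eval e p ∧
    ∀ x : Fin n → ℝ, (restrictLine p x (-e)).Splits

/-- The hyperbolicity cone: all `x` such that all roots of `t ↦ p (t e - x)` are nonnegative. -/
def hyperbolicityCone (p : MvPolynomial (Fin n) ℝ) (e : Fin n → ℝ) : Set (Fin n → ℝ) :=
  {x | ∀ t : ℝ, (restrictLine p (-x) e).IsRoot t → 0 ≤ t}

/-- The rank of `x` with respect to `p` and `e`: the number of nonzero roots of `t ↦ p (t e - x)`,
counted with multiplicity. -/
def hypRank (p : MvPolynomial (Fin n) ℝ) (e x : Fin n → ℝ) : ℕ :=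
  ((restrictLine p (-x) e).roots.filter (fun t => t ≠ 0)).card

/-- The hyperbolicity cone of `p` along `e` is rank-one generated (with respect to `p`): its
extreme rays are generated by elements of rank one. -/
def IsROG (p : MvPolynomial (Fin n) ℝ) (e : Fin n → ℝ) : Prop :=
  ∀ x, GeneratesExtremeRay (hyperbolicityCone p e) x → hypRank p e x = 1

/-- `K` is realizable as a rank-one generated hyperbolicity cone. -/
def IsROGRealizable (K : Set (Fin n → ℝ)) : Prop :=
  ∃ (p : MvPolynomial (Fin n) ℝ) (e : Fin n → ℝ),
    IsHyperbolic p e ∧ K = hyperbolicityCone p e ∧ IsROG p e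

end Hyperbolic

/-- The Vinberg cone in `ℝ⁵`; the coordinates `y₁, …, y₅` are `y 0, …, y 4`. -/
def vinbergCone : Set (Fin 5 → ℝ) :=
  {y | (!![y 0, y 1; y 1, y 3] : Matrix (Fin 2) (Fin 2) ℝ).PosSemidef ∧
    (!![y 0, y 2; y 2, y 4] : Matrix (Fin 2) (Fin 2) ℝ).PosSemidef}

end VinbergROG

end

noncomputable section

namespace VinbergROG

open MvPolynomial Filter Topology

/-! ### Cones -/

section Cones

variable {V : Type*} [NormedAddCommGroup V] [NormedSpace ℝ V]

/-! Homogeneity is Cholesky factorization: congruence by lower triangular matrices sharing their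
upper left entry carries the point with both blocks the identity to any point with positive definite
blocks.

For the failure of ROG, let `p` and `e` realize the cone. A supporting functional forces `p` to
vanish on its face (`IsHyperbolic.eval_eq_zero`). Where the first block is singular and `y 0 > 0`,
raising `y 4` reaches the cone, so `p`, a polynomial in `y 4`, vanishes for every `y 4`, even when
the second block is indefinite. The points `(1, a, b, a², b²)` generate extreme rays. For suitable
`a, b` the two block determinants of `t e - x` have distinct nonzero roots. At the smaller one the
first block is singular; at the larger one the second is singular and the first positive
semidefinite. Both are roots of `p (t e - x)`, so the rank is not one. -/

/-- From a relative interior point of `K` one can move a little along every difference of two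
points of `K`. -/
theorem exists_add_smul_sub_mem {K : Set V} {x u v : V} (hx : x ∈ intrinsicInterior ℝ K)
    (hu : u ∈ K) (hv : v ∈ K) : ∃ ε : ℝ, 0 < ε ∧ x + ε • (u - v) ∈ K := by
  obtain ⟨x', hx', rfl⟩ := mem_intrinsicInterior.1 hx
  have hmem : ∀ t : ℝ, (x' : V) + t • (u - v) ∈ affineSpan ℝ K := fun t => by
    have := AffineSubspace.smul_vsub_vadd_mem (affineSpan ℝ K) t (subset_affineSpan ℝ K hu)
      (subset_affineSpan ℝ K hv) x'.2
    simpa [add_comm] using this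
  let f : ℝ → affineSpan ℝ K := fun t => ⟨(x' : V) + t • (u - v), hmem t⟩
  have hf : Continuous f := by
    refine Continuous.subtype_mk ?_ _
    fun_prop
  have hf0 : f 0 = x' := Subtype.ext (by simp [f])
  have hev : ∀ᶠ t in 𝓝 (0 : ℝ), f t ∈ ((↑) ⁻¹' K : Set (affineSpan ℝ K)) :=
    hf.continuousAt.eventually_mem (by rw [hf0]; exact mem_interior_iff_mem_nhds.1 hx')
  obtain ⟨ε, hε, h⟩ := Metric.eventually_nhds_iff.1 hev
  refine ⟨ε / 2, half_pos hε, h (y := ε / 2) ?_⟩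
  rw [Real.dist_eq, sub_zero, abs_of_pos (half_pos hε)]
  exact half_lt_self hε

end Cones

/-! ### Hyperbolicity cones -/

section Hyperbolic

variable {n : ℕ} {p : MvPolynomial (Fin n) ℝ} {e : Fin n → ℝ}

theorem isRoot_restrictLine {a b : Fin n → ℝ} {t : ℝ} :
    (restrictLine p a b).IsRoot t ↔ eval (a + t • b) p = 0 := by
  rw [Polynomial.IsRoot.def, eval_restrictLine]

theorem eval_smul_of_isHomogeneous {d : ℕ} (hp : p.IsHomogeneous d) (c : ℝ) (x : Fin n → ℝ) :
    eval (c • x) p = c ^ d * eval x p := by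
  rw [eval_eq, eval_eq, Finset.mul_sum]
  refine Finset.sum_congr rfl fun m hm => ?_
  have hd : ∑ i ∈ m.support, m i = d := by
    have := hp (mem_support_iff.1 hm)
    rwa [Finsupp.weight_apply, Finsupp.sum, Finset.sum_congr rfl fun i _ => by
      rw [Pi.one_apply, smul_eq_mul, mul_one]] at this
  simp only [Pi.smul_apply, smul_eq_mul, mul_pow, Finset.prod_mul_distrib,
    Finset.prod_pow_eq_pow_sum, hd]
  ring

theorem IsHyperbolic.eval_neg_eq_zero (hp : IsHyperbolic p e) {x : Fin n → ℝ}
    (h : eval (-x) p = 0) : eval x p = 0 := by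
  obtain ⟨d, hd⟩ := hp.1
  have := eval_smul_of_isHomogeneous hd (-1) (-x)
  rwa [h, mul_zero, neg_one_smul, neg_neg] at this

/-- A hyperbolic polynomial does not vanish on a line in the direction of hyperbolicity. -/
theorem IsHyperbolic.restrictLine_ne_zero (hp : IsHyperbolic p e) (v : Fin n → ℝ) :
    restrictLine p v e ≠ 0 := by
  intro h0
  obtain ⟨d, hd⟩ := hp.1
  -- By homogeneity, vanishing on `v + ℝ e` gives vanishing at `e + s v` for `s > 0`, hence also at
  -- `s = 0`, against `p e > 0`.
  have hz : restrictLine p e v = 0 := by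
    refine Polynomial.eq_zero_of_infinite_isRoot _ ((Set.Ioi_infinite (0 : ℝ)).mono ?_)
    intro s (hs : 0 < s)
    refine isRoot_restrictLine.2 ?_
    have h1 : e + s • v = s • (v + s⁻¹ • e) := by
      rw [smul_add, smul_smul, mul_inv_cancel₀ hs.ne', one_smul, add_comm]
    rw [h1, eval_smul_of_isHomogeneous hd, ← eval_restrictLine, h0, Polynomial.eval_zero, mul_zero]
  have h2 := eval_restrictLine p e v 0
  rw [hz, Polynomial.eval_zero, zero_smul, add_zero] at h2
  exact hp.2.1.ne h2

/-- The direction of hyperbolicity is an order unit of the hyperbolicity cone. -/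
theorem IsHyperbolic.exists_smul_sub_mem (hp : IsHyperbolic p e) (v : Fin n → ℝ) :
    ∃ M : ℝ, M • e - v ∈ hyperbolicityCone p e := by
  obtain ⟨m, hm⟩ := Polynomial.exists_min_root _ (hp.restrictLine_ne_zero v)
  refine ⟨-m, fun t ht => ?_⟩
  have h1 : -(-m • e - v) + t • e = v + (t + m) • e := by module
  rw [isRoot_restrictLine, h1] at ht
  linarith [hm _ (isRoot_restrictLine.2 ht)]

/-- A nonzero linear functional that is nonnegative on the hyperbolicity cone is positive at the
direction of hyperbolicity. -/
theorem IsHyperbolic.linearMap_pos (hp : IsHyperbolic p e) {l : (Fin n → ℝ) →ₗ[ℝ] ℝ}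
    (hl : ∀ y ∈ hyperbolicityCone p e, 0 ≤ l y) (hl0 : l ≠ 0) : 0 < l e := by
  by_contra! hle
  refine hl0 (LinearMap.ext fun v => ?_)
  have he : 0 ≤ l e := hl e fun t ht => by
    obtain ⟨d, hd⟩ := hp.1
    rw [isRoot_restrictLine, show -e + t • e = (t - 1) • e by module,
      eval_smul_of_isHomogeneous hd] at ht
    have := (mul_eq_zero.1 ht).resolve_right hp.2.1.ne'
    linarith [eq_zero_of_pow_eq_zero this]
  have he0 : l e = 0 := le_antisymm hle he
  obtain ⟨M, hM⟩ := hp.exists_smul_sub_mem v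
  obtain ⟨N, hN⟩ := hp.exists_smul_sub_mem (-v)
  have h1 := hl _ hM
  have h2 := hl _ hN
  simp only [map_sub, map_smul, map_neg, he0, smul_zero] at h1 h2
  rw [LinearMap.zero_apply]
  linarith

/-- A hyperbolic polynomial vanishes at the points of its hyperbolicity cone that are annihilated
by a nonzero nonnegative linear functional. -/
theorem IsHyperbolic.eval_eq_zero (hp : IsHyperbolic p e) {l : (Fin n → ℝ) →ₗ[ℝ] ℝ}
    (hl : ∀ y ∈ hyperbolicityCone p e, 0 ≤ l y) (hl0 : l ≠ 0) {x : Fin n → ℝ}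
    (hx : x ∈ hyperbolicityCone p e) (hlx : l x = 0) : eval x p = 0 := by
  have hle := hp.linearMap_pos hl hl0
  refine hp.eval_neg_eq_zero ?_
  by_contra hne
  have hcont : Continuous fun t : ℝ => (restrictLine p (-x) e).eval t :=
    (restrictLine p (-x) e).continuous
  -- If `p (-x) ≠ 0`, the roots stay at least some `ε > 0` away from zero, so `x - ε e` is still in
  -- the cone, although `l` is negative there.
  have hev : ∀ᶠ t in 𝓝 (0 : ℝ), (restrictLine p (-x) e).eval t ≠ 0 := by
    refine hcont.continuousAt.eventually_ne ?_
    rwa [eval_restrictLine, zero_smul, add_zero]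
  obtain ⟨ε, hε, h⟩ := Metric.eventually_nhds_iff.1 hev
  have hnot : x - ε • e ∉ hyperbolicityCone p e := fun hmem => by
    have := hl _ hmem
    rw [map_sub, map_smul, hlx, smul_eq_mul] at this
    nlinarith
  simp only [hyperbolicityCone, Set.mem_ofPred_eq, not_forall, not_le] at hnot
  obtain ⟨t, ht, ht0⟩ := hnot
  rw [isRoot_restrictLine, show -(x - ε • e) + t • e = -x + (t + ε) • e by module,
    ← isRoot_restrictLine] at ht
  refine h (y := t + ε) ?_ ht
  rw [Real.dist_eq, sub_zero, abs_of_nonneg (hx _ ht)]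
  linarith

/-- Two distinct nonzero roots force rank at least two. -/
theorem hypRank_ne_one {x : Fin n → ℝ} {s t : ℝ} (hs : s ≠ 0) (ht : t ≠ 0) (hst : s ≠ t)
    (hps : eval (s • e - x) p = 0) (hpt : eval (t • e - x) p = 0) : hypRank p e x ≠ 1 := by
  intro h
  obtain ⟨r, hr⟩ := Multiset.card_eq_one.1 h
  have hne : restrictLine p (-x) e ≠ 0 := fun h0 => by simp [h0] at hr
  have key : ∀ c : ℝ, c ≠ 0 → eval (c • e - x) p = 0 → c = r := fun c hc hpc => by
    rw [← Multiset.mem_singleton, ← hr, Multiset.mem_filter, Polynomial.mem_roots hne,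
      isRoot_restrictLine, neg_add_eq_sub]
    exact ⟨hpc, hc⟩
  exact hst ((key s hs hps).trans (key t ht hpt).symm)

end Hyperbolic

/-! ### The Vinberg cone -/

theorem posSemidef_fin_two_iff {a b c : ℝ} :
    (!![a, b; b, c] : Matrix (Fin 2) (Fin 2) ℝ).PosSemidef ↔
      ∀ s t : ℝ, 0 ≤ s ^ 2 * a + 2 * s * t * b + t ^ 2 * c := by
  rw [Matrix.posSemidef_iff_dotProduct_mulVec]
  have hform : ∀ x : Fin 2 → ℝ, star x ⬝ᵥ (!![a, b; b, c] : Matrix (Fin 2) (Fin 2) ℝ).mulVec x =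
      x 0 ^ 2 * a + 2 * x 0 * x 1 * b + x 1 ^ 2 * c := fun x => by
    simp [Matrix.mulVec, dotProduct, Fin.sum_univ_two]
    ring
  refine ⟨fun h s t => ?_, fun h => ⟨?_, fun x => ?_⟩⟩
  · have := @h.2 ![s, t]
    rw [hform] at this
    simpa using this
  · ext i j
    fin_cases i <;> fin_cases j <;> rfl
  · rw [hform]
    exact h _ _

theorem forall_quadratic_nonneg_iff {a b c : ℝ} :
    (∀ s t : ℝ, 0 ≤ s ^ 2 * a + 2 * s * t * b + t ^ 2 * c) ↔
      0 ≤ a ∧ 0 ≤ c ∧ b ^ 2 ≤ a * c := by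
  constructor
  · intro h
    have ha : 0 ≤ a := by simpa using h 1 0
    have hc : 0 ≤ c := by simpa using h 0 1
    refine ⟨ha, hc, ?_⟩
    rcases ha.eq_or_lt with rfl | ha'
    · rcases hc.eq_or_lt with rfl | hc'
      · nlinarith [h 1 (-b)]
      · by_contra! hlt
        nlinarith [h c (-b)]
    · by_contra! hlt
      nlinarith [h b (-a)]
  · rintro ⟨ha, hc, hb⟩ s t
    rcases ha.eq_or_lt with rfl | ha'
    · have : b = 0 := by nlinarith
      subst this
      have := mul_nonneg (sq_nonneg t) hc
      linarith
    · have h1 : 0 ≤ a * (s ^ 2 * a + 2 * s * t * b + t ^ 2 * c) := by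
        have := mul_nonneg (sq_nonneg t) (sub_nonneg.2 hb)
        nlinarith [sq_nonneg (a * s + b * t)]
      exact nonneg_of_mul_nonneg_right h1 ha'

/-- These inequalities are linear in `y`, which makes convexity and stability under congruence
immediate. -/
theorem mem_vinbergCone_iff_forall {y : Fin 5 → ℝ} : y ∈ vinbergCone ↔
    (∀ s t : ℝ, 0 ≤ s ^ 2 * y 0 + 2 * s * t * y 1 + t ^ 2 * y 3) ∧
      ∀ s t : ℝ, 0 ≤ s ^ 2 * y 0 + 2 * s * t * y 2 + t ^ 2 * y 4 := by
  rw [vinbergCone, Set.mem_ofPred_eq, posSemidef_fin_two_iff, posSemidef_fin_two_iff]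

theorem mem_vinbergCone {y : Fin 5 → ℝ} : y ∈ vinbergCone ↔
    0 ≤ y 0 ∧ (0 ≤ y 3 ∧ y 1 ^ 2 ≤ y 0 * y 3) ∧ 0 ≤ y 4 ∧ y 2 ^ 2 ≤ y 0 * y 4 := by
  rw [mem_vinbergCone_iff_forall, forall_quadratic_nonneg_iff, forall_quadratic_nonneg_iff]
  tauto

theorem isClosedConvexCone_vinbergCone : IsClosedConvexCone vinbergCone where
  zero_mem := by simp [mem_vinbergCone]
  smul_mem c hc x hx := by
    rw [mem_vinbergCone_iff_forall] at hx ⊢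
    refine ⟨fun s t => ?_, fun s t => ?_⟩
    · have := mul_nonneg hc (hx.1 s t)
      simp only [Pi.smul_apply, smul_eq_mul]
      linarith
    · have := mul_nonneg hc (hx.2 s t)
      simp only [Pi.smul_apply, smul_eq_mul]
      linarith
  convex x hx y hy a b ha hb _ := by
    rw [mem_vinbergCone_iff_forall] at hx hy ⊢
    refine ⟨fun s t => ?_, fun s t => ?_⟩
    · have h1 := mul_nonneg ha (hx.1 s t)
      have h2 := mul_nonneg hb (hy.1 s t)
      simp only [Pi.add_apply, Pi.smul_apply, smul_eq_mul]
      linarith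
    · have h1 := mul_nonneg ha (hx.2 s t)
      have h2 := mul_nonneg hb (hy.2 s t)
      simp only [Pi.add_apply, Pi.smul_apply, smul_eq_mul]
      linarith
  isClosed := by
    have : vinbergCone = {y : Fin 5 → ℝ | 0 ≤ y 0 ∧ (0 ≤ y 3 ∧ y 1 ^ 2 ≤ y 0 * y 3) ∧
        0 ≤ y 4 ∧ y 2 ^ 2 ≤ y 0 * y 4} := Set.ext fun _ => mem_vinbergCone
    rw [this]
    refine .and (isClosed_le ?_ ?_) (.and (.and (isClosed_le ?_ ?_) (isClosed_le ?_ ?_))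
      (.and (isClosed_le ?_ ?_) (isClosed_le ?_ ?_))) <;> fun_prop

theorem isPointed_vinbergCone : IsPointed vinbergCone := by
  refine Set.Subset.antisymm ?_ ?_
  · rintro y ⟨h1, h2⟩
    rw [Set.mem_ofPred_eq] at h2
    rw [mem_vinbergCone] at h1 h2
    simp only [Pi.neg_apply] at h2
    obtain ⟨a0, ⟨a3, a1⟩, a4, a2⟩ := h1
    obtain ⟨b0, ⟨b3, -⟩, b4, -⟩ := h2
    have y0 : y 0 = 0 := by linarith
    have y1 : y 1 = 0 := by rw [y0] at a1; nlinarith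
    have y2 : y 2 = 0 := by rw [y0] at a2; nlinarith
    ext i
    fin_cases i
    exacts [y0, y1, y2, by simp; linarith, by simp; linarith]
  · rintro _ rfl
    simp [mem_vinbergCone]

theorem isFullDimensional_vinbergCone : IsFullDimensional vinbergCone := by
  refine eq_top_iff.2 fun y _ => ?_
  have hy : y = (y 0 - y 1 - y 2) • ![1, 0, 0, 0, 0] + (y 3 - y 1) • ![0, 0, 0, 1, 0] +
      (y 4 - y 2) • ![0, 0, 0, 0, 1] + y 1 • ![1, 1, 0, 1, 0] + y 2 • ![1, 0, 1, 0, 1] := by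
    ext i
    fin_cases i <;> simp
    ring
  rw [hy]
  refine add_mem (add_mem (add_mem (add_mem ?_ ?_) ?_) ?_) ?_ <;>
    refine Submodule.smul_mem _ _ (Submodule.subset_span (mem_vinbergCone.2 ?_)) <;> simp

/-! ### Homogeneity of the Vinberg cone -/

/-- The linear map of `ℝ⁵` that acts on the two matrix blocks of the Vinberg cone by congruence
with the lower triangular matrices with rows `(a, 0), (b, c)` and `(a, 0), (b', c')`. -/
def triangularMap (a b c b' c' : ℝ) : (Fin 5 → ℝ) →ₗ[ℝ] (Fin 5 → ℝ) where
  toFun y := ![a ^ 2 * y 0, a * b * y 0 + a * c * y 1, a * b' * y 0 + a * c' * y 2,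
    b ^ 2 * y 0 + 2 * b * c * y 1 + c ^ 2 * y 3,
    b' ^ 2 * y 0 + 2 * b' * c' * y 2 + c' ^ 2 * y 4]
  map_add' x y := by ext i; fin_cases i <;> simp <;> ring
  map_smul' r y := by ext i; fin_cases i <;> simp <;> ring

theorem triangularMap_mem_vinbergCone (a b c b' c' : ℝ) {y : Fin 5 → ℝ} (hy : y ∈ vinbergCone) :
    triangularMap a b c b' c' y ∈ vinbergCone := by
  rw [mem_vinbergCone_iff_forall] at hy ⊢
  refine ⟨fun s t => ?_, fun s t => ?_⟩
  -- The form of `L Y Lᵀ` at a vector is the form of `Y` at its image under `Lᵀ`.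
  · have := hy.1 (s * a + t * b) (t * c)
    simp only [triangularMap, LinearMap.coe_mk, AddHom.coe_mk, Matrix.cons_val]
    linarith
  · have := hy.2 (s * a + t * b') (t * c')
    simp only [triangularMap, LinearMap.coe_mk, AddHom.coe_mk, Matrix.cons_val]
    linarith

theorem triangularMap_triangularMap (a b c b' c' α β γ β' γ' : ℝ) (y : Fin 5 → ℝ) :
    triangularMap a b c b' c' (triangularMap α β γ β' γ' y) =
      triangularMap (a * α) (b * α + c * β) (c * γ) (b' * α + c' * β') (c' * γ') y := by
  ext i
  fin_cases i <;> simp [triangularMap] <;> ring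

theorem triangularMap_one (y : Fin 5 → ℝ) : triangularMap 1 0 1 0 1 y = y := by
  ext i
  fin_cases i <;> simp [triangularMap]

/-- An invertible triangular map as a linear equivalence. -/
def triangularEquiv (a b c b' c' : ℝ) (ha : a ≠ 0) (hc : c ≠ 0) (hc' : c' ≠ 0) :
    (Fin 5 → ℝ) ≃ₗ[ℝ] (Fin 5 → ℝ) :=
  LinearEquiv.ofLinearMap (triangularMap a b c b' c')
    (triangularMap a⁻¹ (-(b / (a * c))) c⁻¹ (-(b' / (a * c'))) c'⁻¹)
    (LinearMap.ext fun y => by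
      rw [LinearMap.comp_apply, triangularMap_triangularMap, LinearMap.id_apply]
      conv_rhs => rw [← triangularMap_one y]
      congr <;> field_simp <;> ring)
    (LinearMap.ext fun y => by
      rw [LinearMap.comp_apply, triangularMap_triangularMap, LinearMap.id_apply]
      conv_rhs => rw [← triangularMap_one y]
      congr <;> field_simp <;> ring)

theorem isConeAut_triangularEquiv (a b c b' c' : ℝ) (ha : a ≠ 0) (hc : c ≠ 0) (hc' : c' ≠ 0) :
    IsConeAut vinbergCone (triangularEquiv a b c b' c' ha hc hc') := by
  refine Set.Subset.antisymm ?_ fun y hy => ?_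
  · rintro _ ⟨y, hy, rfl⟩
    exact triangularMap_mem_vinbergCone _ _ _ _ _ hy
  · exact ⟨(triangularEquiv a b c b' c' ha hc hc').symm y,
      triangularMap_mem_vinbergCone _ _ _ _ _ hy, LinearEquiv.apply_symm_apply _ _⟩

theorem pos_of_mem_intrinsicInterior_vinbergCone {x : Fin 5 → ℝ}
    (hx : x ∈ intrinsicInterior ℝ vinbergCone) :
    0 < x 0 ∧ x 1 ^ 2 < x 0 * x 3 ∧ x 2 ^ 2 < x 0 * x 4 := by
  have hu : (![1, 0, 0, 1, 1] : Fin 5 → ℝ) ∈ vinbergCone := by simp [mem_vinbergCone]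
  -- Subtracting a small multiple of the identity from both blocks stays in the cone.
  obtain ⟨ε, hε, h⟩ := exists_add_smul_sub_mem hx isClosedConvexCone_vinbergCone.zero_mem hu
  rw [mem_vinbergCone] at h
  simp [Matrix.cons_val] at h
  obtain ⟨h0, ⟨h3, h1⟩, h4, h2⟩ := h
  refine ⟨by linarith, by nlinarith, by nlinarith⟩

/-- The automorphisms of the Vinberg cone act transitively from the base point to the points with
positive definite blocks. -/
theorem exists_isConeAut_apply_eq {x : Fin 5 → ℝ} (h0 : 0 < x 0) (h1 : x 1 ^ 2 < x 0 * x 3)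
    (h2 : x 2 ^ 2 < x 0 * x 4) :
    ∃ A : (Fin 5 → ℝ) ≃ₗ[ℝ] (Fin 5 → ℝ),
      IsConeAut vinbergCone A ∧ A ![1, 0, 0, 1, 1] = x := by
  have ha : 0 < √(x 0) := Real.sqrt_pos.2 h0
  have hc : 0 < x 3 - x 1 ^ 2 / x 0 := by
    rw [sub_pos, div_lt_iff₀ h0]; linarith
  have hc' : 0 < x 4 - x 2 ^ 2 / x 0 := by
    rw [sub_pos, div_lt_iff₀ h0]; linarith
  refine ⟨triangularEquiv (√(x 0)) (x 1 / √(x 0)) (√(x 3 - x 1 ^ 2 / x 0)) (x 2 / √(x 0))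
    (√(x 4 - x 2 ^ 2 / x 0)) ha.ne' (Real.sqrt_pos.2 hc).ne' (Real.sqrt_pos.2 hc').ne',
    isConeAut_triangularEquiv _ _ _ _ _ _ _ _, ?_⟩
  ext i
  fin_cases i <;> simp [triangularEquiv, triangularMap, div_pow, Real.sq_sqrt, h0.le, hc.le, hc'.le,
    mul_div_cancel₀, ha.ne']

theorem isHomogeneousCone_vinbergCone : IsHomogeneousCone vinbergCone where
  isClosedConvexCone := isClosedConvexCone_vinbergCone
  transitive x hx y hy := by
    obtain ⟨hx0, hx1, hx2⟩ := pos_of_mem_intrinsicInterior_vinbergCone hx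
    obtain ⟨hy0, hy1, hy2⟩ := pos_of_mem_intrinsicInterior_vinbergCone hy
    obtain ⟨A, hA, hAx⟩ := exists_isConeAut_apply_eq hx0 hx1 hx2
    obtain ⟨B, hB, hBy⟩ := exists_isConeAut_apply_eq hy0 hy1 hy2
    refine ⟨A.symm.trans B, ?_, ?_⟩
    · have hA' : A.symm '' vinbergCone = vinbergCone := by
        conv_lhs => rw [← hA]
        rw [← Set.image_comp]
        simp
      exact (Set.image_comp B A.symm vinbergCone).trans ((congrArg (B '' ·) hA').trans hB)
    · rw [LinearEquiv.trans_apply, ← hAx, LinearEquiv.symm_apply_apply, hBy]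

/-! ### Rank of the extreme rays of the Vinberg cone -/

/-- The quadratic form of the matrix with entries `y 0, y j, y k`, evaluated at `(s, t)`, as a
linear functional of `y`. -/
def blockForm (j k : Fin 5) (s t : ℝ) : (Fin 5 → ℝ) →ₗ[ℝ] ℝ :=
  s ^ 2 • LinearMap.proj 0 + (2 * s * t) • LinearMap.proj j + t ^ 2 • LinearMap.proj k

theorem blockForm_apply (j k : Fin 5) (s t : ℝ) (y : Fin 5 → ℝ) :
    blockForm j k s t y = s ^ 2 * y 0 + 2 * s * t * y j + t ^ 2 * y k := rfl

theorem blockForm_ne_zero {j k : Fin 5} (hk : k ≠ 0) (hjk : k ≠ j) (s : ℝ) {t : ℝ} (ht : t ≠ 0) :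
    blockForm j k s t ≠ 0 := by
  intro h
  have := LinearMap.congr_fun h (Pi.single k 1)
  rw [blockForm_apply, Pi.single_eq_of_ne hk.symm, Pi.single_eq_of_ne hjk.symm,
    Pi.single_eq_same] at this
  simp [ht] at this

theorem blockForm_one_three_nonneg (s t : ℝ) : ∀ y ∈ vinbergCone, 0 ≤ blockForm 1 3 s t y :=
  fun _ hy => (mem_vinbergCone_iff_forall.1 hy).1 s t

theorem blockForm_two_four_nonneg (s t : ℝ) : ∀ y ∈ vinbergCone, 0 ≤ blockForm 2 4 s t y :=
  fun _ hy => (mem_vinbergCone_iff_forall.1 hy).2 s t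

/-- Two nonnegative functionals vanish at this point, hence at both ends of any segment through a
point of its ray; with the determinant inequalities they cut out exactly the ray. -/
theorem generatesExtremeRay_vinbergCone (a b : ℝ) :
    GeneratesExtremeRay vinbergCone ![1, a, b, a ^ 2, b ^ 2] := by
  have hx : (![1, a, b, a ^ 2, b ^ 2] : Fin 5 → ℝ) ∈ vinbergCone := by
    simp [mem_vinbergCone, sq_nonneg]
  refine ⟨fun h => by simpa using congrFun h 0, ?_, ?_⟩
  · rintro _ ⟨c, hc, rfl⟩
    exact isClosedConvexCone_vinbergCone.smul_mem c hc _ hx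
  · rintro u hu w hw _ ⟨c, -, rfl⟩ ⟨α, β, hα, hβ, -, h⟩
    have key : ∀ l : (Fin 5 → ℝ) →ₗ[ℝ] ℝ, (∀ y ∈ vinbergCone, 0 ≤ l y) →
        l ![1, a, b, a ^ 2, b ^ 2] = 0 → l u = 0 := fun l hl hl0 => by
      have h1 := congrArg l h
      simp only [map_add, map_smul, hl0, smul_eq_mul, mul_zero] at h1
      have h2 := mul_nonneg hβ.le (hl w hw)
      have h3 := hl u hu
      have h4 : α * l u ≤ 0 := by linarith
      exact le_antisymm (nonpos_of_mul_nonpos_right h4 hα) h3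
    have k1 := key _ (blockForm_one_three_nonneg a (-1)) (by simp [blockForm_apply]; ring)
    have k2 := key _ (blockForm_two_four_nonneg b (-1)) (by simp [blockForm_apply]; ring)
    rw [blockForm_apply] at k1 k2
    obtain ⟨h0, ⟨-, h1⟩, -, h2⟩ := mem_vinbergCone.1 hu
    have e3 : u 3 = 2 * a * u 1 - a ^ 2 * u 0 := by linarith
    have e4 : u 4 = 2 * b * u 2 - b ^ 2 * u 0 := by linarith
    rw [e3] at h1
    rw [e4] at h2
    have e1 : u 1 - a * u 0 = 0 := by nlinarith [sq_nonneg (u 1 - a * u 0)]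
    have e2 : u 2 - b * u 0 = 0 := by nlinarith [sq_nonneg (u 2 - b * u 0)]
    rw [sub_eq_zero] at e1 e2
    refine ⟨u 0, h0, ?_⟩
    ext i
    fin_cases i <;> simp [e1, e2, e3, e4] <;> ring

/-! ### Polynomials realizing the Vinberg cone -/

section Realization

variable {p : MvPolynomial (Fin 5) ℝ} {e : Fin 5 → ℝ}

/-- A hyperbolic polynomial whose hyperbolicity cone is the Vinberg cone vanishes where the first
block is singular. -/
theorem IsHyperbolic.eval_eq_zero_of_det_one_three (hp : IsHyperbolic p e)
    (hK : vinbergCone = hyperbolicityCone p e) {y : Fin 5 → ℝ} (h0 : 0 < y 0)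
    (h1 : y 0 * y 3 = y 1 ^ 2) : eval y p = 0 := by
  have hz : restrictLine p (Function.update y 4 0) (Pi.single 4 1) = 0 := by
    refine Polynomial.eq_zero_of_infinite_isRoot _ ((Set.Ici_infinite (y 2 ^ 2 / y 0)).mono ?_)
    intro t (ht : _ ≤ t)
    -- The vector `(-y 1, y 0)` spans the kernel of the singular block.
    refine isRoot_restrictLine.2 (hp.eval_eq_zero (l := blockForm 1 3 (-y 1) (y 0))
      (hK ▸ blockForm_one_three_nonneg _ _) (blockForm_ne_zero (by decide) (by decide) _ h0.ne')
      (hK ▸ mem_vinbergCone.2 ?_) ?_)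
    · have ht' : y 2 ^ 2 ≤ y 0 * t := by rwa [div_le_iff₀' h0] at ht
      have ht0 : 0 ≤ t := (by positivity : 0 ≤ y 2 ^ 2 / y 0).trans ht
      have h3 : 0 ≤ y 3 := nonneg_of_mul_nonneg_right (h1 ▸ sq_nonneg (y 1)) h0
      simp [h0.le, h3, h1, ht', ht0]
    · simp [blockForm_apply]
      linear_combination y 0 * h1
  have h := eval_restrictLine p (Function.update y 4 0) (Pi.single 4 1) (y 4)
  rw [hz, Polynomial.eval_zero] at h
  have hy : Function.update y 4 0 + y 4 • Pi.single 4 1 = y := by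
    ext i
    fin_cases i <;> simp
  rw [hy] at h
  exact h.symm

/-- A hyperbolic polynomial whose hyperbolicity cone is the Vinberg cone vanishes where the second
block is singular and the first one is positive semidefinite. -/
theorem IsHyperbolic.eval_eq_zero_of_det_two_four (hp : IsHyperbolic p e)
    (hK : vinbergCone = hyperbolicityCone p e) {y : Fin 5 → ℝ} (h0 : 0 < y 0)
    (h1 : y 1 ^ 2 ≤ y 0 * y 3) (h2 : y 0 * y 4 = y 2 ^ 2) : eval y p = 0 := by
  refine hp.eval_eq_zero (l := blockForm 2 4 (-y 2) (y 0))
    (hK ▸ blockForm_two_four_nonneg _ _) (blockForm_ne_zero (by decide) (by decide) _ h0.ne')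
    (hK ▸ mem_vinbergCone.2 ⟨h0.le, ⟨?_, h1⟩, ?_, h2.ge⟩) ?_
  · exact nonneg_of_mul_nonneg_right ((sq_nonneg _).trans h1) h0
  · exact nonneg_of_mul_nonneg_right (h2 ▸ sq_nonneg _) h0
  · rw [blockForm_apply]
    linear_combination y 0 * h2

/-- The direction of hyperbolicity has positive definite blocks. -/
theorem IsHyperbolic.pos_of_eq_vinbergCone (hp : IsHyperbolic p e)
    (hK : vinbergCone = hyperbolicityCone p e) :
    0 < e 0 ∧ 0 < e 0 * e 3 - e 1 ^ 2 ∧ 0 < e 0 * e 4 - e 2 ^ 2 := by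
  have h0 : 0 < e 0 := by
    refine hp.linearMap_pos (l := LinearMap.proj 0) (hK ▸ fun y hy => (mem_vinbergCone.1 hy).1)
      fun h => ?_
    simpa using LinearMap.congr_fun h (Pi.single 0 1)
  have h1 := hp.linearMap_pos (hK ▸ blockForm_one_three_nonneg (-e 1) (e 0))
    (blockForm_ne_zero (by decide) (by decide) _ h0.ne')
  have h2 := hp.linearMap_pos (hK ▸ blockForm_two_four_nonneg (-e 2) (e 0))
    (blockForm_ne_zero (by decide) (by decide) _ h0.ne')
  rw [blockForm_apply] at h1 h2
  refine ⟨h0, pos_of_mul_pos_right (a := e 0) ?_ h0.le, pos_of_mul_pos_right (a := e 0) ?_ h0.le⟩ <;>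
    linarith

end Realization

/-- For `E` with entries `u, v, w` and `z = (1, v/u + m r)`, the determinant of `t E - z zᵀ` has
nonzero root `zᵀ E⁻¹ z`; this `z` makes it independent of `v` and `w`. -/
theorem det_sub_rank_one {u v w r m : ℝ} (hu : u ≠ 0) (hr : r ^ 2 = u * w - v ^ 2) (t : ℝ) :
    (t * u - 1) * (t * w - (v / u + m * r) ^ 2) - (t * v - (v / u + m * r)) ^ 2 =
      t * (u * w - v ^ 2) * (t - (u⁻¹ + m ^ 2 * u)) := by
  have hw : w = (r ^ 2 + v ^ 2) / u := by
    rw [hr]; field_simp; ring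
  subst hw
  field_simp
  ring

theorem not_isROGRealizable_vinbergCone : ¬ IsROGRealizable vinbergCone := by
  rintro ⟨p, e, hp, hK, hrog⟩
  obtain ⟨h0, h1, h2⟩ := hp.pos_of_eq_vinbergCone hK
  -- Both blocks share `u = e 0`, so different values of `m` give different roots.
  have det1 := det_sub_rank_one (m := 1) h0.ne' (Real.sq_sqrt h1.le)
  have det2 := det_sub_rank_one (m := 2) h0.ne' (Real.sq_sqrt h2.le)
  set a := e 1 / e 0 + 1 * √(e 0 * e 3 - e 1 ^ 2)
  set b := e 2 / e 0 + 2 * √(e 0 * e 4 - e 2 ^ 2)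
  have hinv : (e 0)⁻¹ * e 0 = 1 := inv_mul_cancel₀ h0.ne'
  have hs : 0 < (e 0)⁻¹ + 1 ^ 2 * e 0 := by positivity
  have ht : 0 < (e 0)⁻¹ + 2 ^ 2 * e 0 := by positivity
  refine hypRank_ne_one hs.ne' ht.ne' (by linarith) ?_ ?_
    (hrog _ (hK ▸ generatesExtremeRay_vinbergCone a b))
  · refine hp.eval_eq_zero_of_det_one_three hK ?_ ?_
    · simp [add_mul, hinv, h0]
    · have := det1 ((e 0)⁻¹ + 1 ^ 2 * e 0)
      rw [sub_self, mul_zero, sub_eq_zero] at this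
      exact this
  · refine hp.eval_eq_zero_of_det_two_four hK ?_ ?_ ?_
    · simp [add_mul, hinv, h0]
    -- Past its own root, the first block has nonnegative determinant.
    · have := det1 ((e 0)⁻¹ + 2 ^ 2 * e 0)
      refine sub_nonneg.1 (this.ge.trans' (mul_nonneg (mul_pos ht h1).le ?_))
      linarith
    · have := det2 ((e 0)⁻¹ + 2 ^ 2 * e 0)
      rw [sub_self, mul_zero, sub_eq_zero] at this
      exact this

end VinbergROG

end

theorem mainTheorem4 :
    (VinbergROG.IsHomogeneousCone VinbergROG.vinbergCone ∧
      VinbergROG.IsPointed VinbergROG.vinbergCone ∧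
      VinbergROG.IsFullDimensional VinbergROG.vinbergCone ∧
      ¬ VinbergROG.IsROGRealizable VinbergROG.vinbergCone) ∧
    ¬ (∀ (n : ℕ) (K : Set (Fin n → ℝ)),
        VinbergROG.IsHomogeneousCone K → VinbergROG.IsPointed K →
        VinbergROG.IsFullDimensional K → VinbergROG.IsROGRealizable K) := by
  have h : VinbergROG.IsHomogeneousCone VinbergROG.vinbergCone ∧
      VinbergROG.IsPointed VinbergROG.vinbergCone ∧
      VinbergROG.IsFullDimensional VinbergROG.vinbergCone ∧
      ¬ VinbergROG.IsROGRealizable VinbergROG.vinbergCone :=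
    ⟨VinbergROG.isHomogeneousCone_vinbergCone, VinbergROG.isPointed_vinbergCone,
      VinbergROG.isFullDimensional_vinbergCone, VinbergROG.not_isROGRealizable_vinbergCone⟩
  exact ⟨h, fun H => h.2.2.2 (H 5 _ h.1 h.2.1 h.2.2.1)⟩
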